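/- Let $N\in\mathbb{N}$, let $\mathsf{H}=\mathbb{R}^N$ with its standard inner product $\langle\cdot,\cdot\rangle$ and Euclidean norm, and let $(u_k,\xi_k)_{k\in K_1}$ and $(u_k,\xi_k)_{k\in K_2}$ be two nonempty finite families in $\mathbb{R}^N\times\{-1,1\}$. Let $\alpha\in\,]0,1[$ and set, for every $x\in\mathbb{R}^N$, $$f_k(x)=\alpha\max\{0,1-\xi_k\langle x,u_k\rangle\}\ (k\in K_1),\qquad g_k(x)=(1-\alpha)\ln\bigl(1+\exp(-\xi_k\langle x,u_k\rangle)\bigr)\ (k\in K_2).$$ Let $Z$ be the set of global minimizers over $\mathbb{R}^N$ of $$\frac{1}{\operatorname{card}K_1}\sum_{k\in K_1}f_k+\frac{1}{\operatorname{card}K_2}\sum_{k\in K_2}g_k,$$ and assume that $Z\neq\varnothing$. Let $(\Omega,\mathcal{F},\mathsf{P})$ be a probability space, let $x_0\in L^2(\Omega,\mathcal{F},\mathsf{P};\mathsf{H})$, and let $(\gamma_n)_{n\in\mathbb{N}}$ be a sequence in $]0,+\infty[$ such that $\sum_{n}\gamma_n=+\infty$ and $\sum_{n}\gamma_n^2<+\infty$.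 Suppose that, for every $n\in\mathbb{N}$, $(i_n,j_n)$ is a random variable uniformly distributed on $K_1\times K_2$ and independent of $\sigma(x_0,\ldots,x_n)$, and that $$x_{n+1}=\operatorname{prox}_{\gamma_n f_{i_n}}\bigl(x_n-\gamma_n\nabla g_{j_n}(x_n)\bigr)\quad\mathsf{P}\text{-a.s.},$$ where $\operatorname{prox}_h(x)$ denotes the unique minimizer of $z\mapsto h(z)+\frac12\|x-z\|^2$. Then there exists a $Z$-valued random variable $x$ such that $(x_n)_{n\in\mathbb{N}}$ converges to $x$ $\mathsf{P}$-a.s. and in $L^1(\Omega,\mathcal{F},\mathsf{P};\mathsf{H})$. -/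

import Mathlib

open Filter Topology MeasureTheory ProbabilityTheory

noncomputable section

namespace MixedLoss

variable {N : ℕ}

/-- `p` is a minimizer of `z ↦ h z + (1/2) ‖x - z‖ ^ 2`. -/
def IsProxPoint (h : EuclideanSpace ℝ (Fin N) → ℝ) (x p : EuclideanSpace ℝ (Fin N)) : Prop :=
  IsMinOn (fun z => h z + (1 / 2) * ‖x - z‖ ^ 2) Set.univ p

/-- The proximity operator: `prox h x` is the minimizer of `z ↦ h z + (1/2) ‖x - z‖ ^ 2`. -/
def prox (h : EuclideanSpace ℝ (Fin N) → ℝ) (x : EuclideanSpace ℝ (Fin N)) :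
    EuclideanSpace ℝ (Fin N) :=
  Classical.epsilon (IsProxPoint h x)

/-- The hinge loss of the sample `(u, ξ)` with weight `α`. -/
def hingeLoss (α : ℝ) (u : EuclideanSpace ℝ (Fin N)) (ξ : ℝ)
    (x : EuclideanSpace ℝ (Fin N)) : ℝ :=
  α * max 0 (1 - ξ * inner ℝ x u)

/-- The logistic loss of the sample `(u, ξ)` with weight `1 - α`. -/
def logisticLoss (α : ℝ) (u : EuclideanSpace ℝ (Fin N)) (ξ : ℝ)
    (x : EuclideanSpace ℝ (Fin N)) : ℝ :=
  (1 - α) * Real.log (1 + Real.exp (-ξ * inner ℝ x u))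

/-- The mixed hinge/logistic objective over the two training collections. -/
def objective {K₁ K₂ : Type*} [Fintype K₁] [Fintype K₂] (α : ℝ)
    (u₁ : K₁ → EuclideanSpace ℝ (Fin N)) (ξ₁ : K₁ → ℝ)
    (u₂ : K₂ → EuclideanSpace ℝ (Fin N)) (ξ₂ : K₂ → ℝ)
    (x : EuclideanSpace ℝ (Fin N)) : ℝ :=
  (1 / (Fintype.card K₁ : ℝ)) * ∑ k, hingeLoss α (u₁ k) (ξ₁ k) x +
    (1 / (Fintype.card K₂ : ℝ)) * ∑ k, logisticLoss α (u₂ k) (ξ₂ k) x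

/-- The set of solutions: the global minimizers of the objective. -/
def solutionSet {K₁ K₂ : Type*} [Fintype K₁] [Fintype K₂] (α : ℝ)
    (u₁ : K₁ → EuclideanSpace ℝ (Fin N)) (ξ₁ : K₁ → ℝ)
    (u₂ : K₂ → EuclideanSpace ℝ (Fin N)) (ξ₂ : K₂ → ℝ) : Set (EuclideanSpace ℝ (Fin N)) :=
  {x | IsMinOn (objective α u₁ ξ₁ u₂ ξ₂) Set.univ x}

theorem convexOn_hingeLoss {α : ℝ} (hα : 0 ≤ α) (u : EuclideanSpace ℝ (Fin N)) (ξ : ℝ) :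
    ConvexOn ℝ Set.univ (hingeLoss α u ξ) := by
  refine ⟨convex_univ, fun x _ y _ a b ha hb hab => ?_⟩
  simp only [hingeLoss, smul_eq_mul, inner_add_left, real_inner_smul_left]
  have h1 : max 0 (1 - ξ * (a * inner ℝ x u + b * inner ℝ y u)) ≤
      a * max 0 (1 - ξ * inner ℝ x u) + b * max 0 (1 - ξ * inner ℝ y u) := by
    apply max_le
    · positivity
    · have hx := mul_le_mul_of_nonneg_left (le_max_right 0 (1 - ξ * inner ℝ x u)) ha
      have hy := mul_le_mul_of_nonneg_left (le_max_right 0 (1 - ξ * inner ℝ y u)) hb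
      have hb' : b = 1 - a := by linarith
      subst hb'
      linarith
  calc _ ≤ α * _ := mul_le_mul_of_nonneg_left h1 hα
    _ = _ := by ring

theorem existsUnique_isProxPoint {h : EuclideanSpace ℝ (Fin N) → ℝ}
    (hconv : ConvexOn ℝ Set.univ h) (hcont : Continuous h) (hpos : ∀ z, 0 ≤ h z)
    (x : EuclideanSpace ℝ (Fin N)) : ∃! p, IsProxPoint h x p := by
  have hlim : Tendsto (fun z => h z + (1 / 2) * ‖x - z‖ ^ 2)
      (cocompact (EuclideanSpace ℝ (Fin N))) atTop := by
    refine tendsto_atTop_mono (f := fun z => (1 / 2) * ‖x - z‖ ^ 2)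
      (fun z => by linarith [hpos z]) ?_
    refine Tendsto.const_mul_atTop (by norm_num) ((tendsto_pow_atTop two_ne_zero).comp ?_)
    have := tendsto_dist_right_cocompact_atTop x
    simpa only [dist_eq_norm, norm_sub_rev] using this
  obtain ⟨p, hp⟩ := Continuous.exists_forall_le
    (f := fun z => h z + (1 / 2) * ‖x - z‖ ^ 2) (by fun_prop) hlim
  refine ⟨p, fun z _ => hp z, fun q hq => ?_⟩
  have hqp : h q + (1 / 2) * ‖x - q‖ ^ 2 ≤ h p + (1 / 2) * ‖x - p‖ ^ 2 := hq (Set.mem_univ p)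
  have hm := hp ((1 / 2 : ℝ) • p + (1 / 2 : ℝ) • q)
  have hc := hconv.2 (Set.mem_univ p) (Set.mem_univ q)
    (by norm_num : (0 : ℝ) ≤ 1 / 2) (by norm_num : (0 : ℝ) ≤ 1 / 2) (by norm_num)
  have hpar := parallelogram_law_with_norm ℝ (x - p) (x - q)
  have e1 : x - p + (x - q) = (2 : ℝ) • (x - ((1 / 2 : ℝ) • p + (1 / 2 : ℝ) • q)) := by
    module
  have e2 : x - p - (x - q) = q - p := by abel
  rw [e1, e2, norm_smul] at hpar
  simp only [smul_eq_mul, Real.norm_ofNat] at hc hpar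
  have : ‖q - p‖ ^ 2 ≤ 0 := by nlinarith
  have h0 : ‖q - p‖ = 0 := by nlinarith [norm_nonneg (q - p)]
  exact sub_eq_zero.mp (norm_eq_zero.mp h0)

/-- The proximity operator of a scaled hinge loss is its unique proximal point. -/
theorem isProxPoint_hingeLoss_iff {α γ : ℝ} (hα : 0 ≤ α) (hγ : 0 ≤ γ)
    (u : EuclideanSpace ℝ (Fin N)) (ξ : ℝ) (x p : EuclideanSpace ℝ (Fin N)) :
    IsProxPoint (fun z => γ * hingeLoss α u ξ z) x p ↔
      p = prox (fun z => γ * hingeLoss α u ξ z) x := by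
  have hu : ∃! p, IsProxPoint (fun z => γ * hingeLoss α u ξ z) x p := by
    refine existsUnique_isProxPoint ((convexOn_hingeLoss hα u ξ).smul hγ) ?_ ?_ x
    · unfold hingeLoss
      fun_prop
    · intro z
      unfold hingeLoss
      positivity
  have hs : IsProxPoint _ x (prox (fun z => γ * hingeLoss α u ξ z) x) :=
    Classical.epsilon_spec hu.exists
  exact ⟨fun hp => hu.unique hp hs, fun hp => hp ▸ hs⟩

end MixedLoss

end

namespace MixedLoss

/-! For a pair `k = (i, j)` put `φ k = f_i + g_j`; the average of the `φ k` is the objective `Φ`.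
The losses are convex with bounded slopes, so each step satisfies `‖x (n+1) - z‖² ≤ ‖x n - z‖² - 2 γ
n (φ k (x n) - φ k z) + M γ n²` for every `z` and every step size (`norm_proxGradient_sub_sq_le`).
Independence of the sampled pair from the past turns `φ k` into `Φ` on average
(`setIntegral_comp_indep`).

For a minimizer `z`, `robbins_siegmund` then yields almost sure convergence of `‖x n - z‖` and
summability of `γ n (Φ (x n) - Φ z)`. As `∑ γ n` diverges, some cluster point is a minimizer, and
convergence of the distances forces the whole sequence to it (`exists_tendsto_isMinOn_of_summable`).
Boundedness in `L²` gives uniform integrability, hence `L¹` convergence. -/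

/-- The Robbins–Siegmund almost supermartingale theorem, with the conditional inequality stated
through set integrals and deterministic summable errors. -/
theorem robbins_siegmund {Ω : Type*} {mΩ : MeasurableSpace Ω} {P : Measure Ω} [IsFiniteMeasure P]
    {ℱ : Filtration ℕ mΩ} {D Ψ : ℕ → Ω → ℝ} {η : ℕ → ℝ}
    (hD : StronglyAdapted ℱ D) (hΨ : StronglyAdapted ℱ Ψ)
    (hDi : ∀ n, Integrable (D n) P) (hΨi : ∀ n, Integrable (Ψ n) P)
    (hD0 : ∀ n ω, 0 ≤ D n ω) (hΨ0 : ∀ n ω, 0 ≤ Ψ n ω) (hη0 : ∀ n, 0 ≤ η n) (hη : Summable η)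
    (hstep : ∀ n s, MeasurableSet[ℱ n] s →
      ∫ ω in s, D (n + 1) ω ∂P ≤ ∫ ω in s, (D n ω - Ψ n ω + η n) ∂P) :
    (∃ B, ∀ n, ∫ ω, D n ω ∂P ≤ B) ∧
    ∀ᵐ ω ∂P, (∃ c, Tendsto (fun n => D n ω) atTop (𝓝 c)) ∧ Summable fun n => Ψ n ω := by
  -- The tail of `∑ η` from `n` on: adding it to `D` absorbs the errors, so that `V` is a true
  -- supermartingale.
  set e : ℕ → ℝ := fun n => ∑' m, η m - ∑ m ∈ Finset.range n, η m with he
  have he0 : ∀ n, 0 ≤ e n := fun n => sub_nonneg.2 (hη.sum_le_tsum _ fun m _ => hη0 m)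
  have hesucc : ∀ n, e (n + 1) = e n - η n := fun n => by
    simp only [he, Finset.sum_range_succ]; ring
  have helim : Tendsto e atTop (𝓝 0) := by
    simpa [he] using hη.hasSum.tendsto_sum_nat.const_sub (∑' m, η m)
  set V : ℕ → Ω → ℝ := fun n ω => D n ω + ∑ m ∈ Finset.range n, Ψ m ω + e n with hV
  have hsum0 : ∀ n ω, 0 ≤ ∑ m ∈ Finset.range n, Ψ m ω :=
    fun n ω => Finset.sum_nonneg fun m _ => hΨ0 m ω
  have hV0 : ∀ n ω, 0 ≤ V n ω := fun n ω =>
    add_nonneg (add_nonneg (hD0 n ω) (hsum0 n ω)) (he0 n)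
  have hsi : ∀ n, Integrable (fun ω => ∑ m ∈ Finset.range n, Ψ m ω) P :=
    fun n => integrable_finsetSum _ fun m _ => hΨi m
  have hVi : ∀ n, Integrable (V n) P := fun n =>
    ((hDi n).add (hsi n)).add (integrable_const _)
  have hVad : StronglyAdapted ℱ V := fun n => by
    refine ((hD n).add ?_).add stronglyMeasurable_const
    refine Finset.stronglyMeasurable_fun_sum _ fun m hm => ?_
    exact (hΨ m).mono (ℱ.mono (Finset.mem_range.1 hm).le)
  have hsuper : Supermartingale V ℱ P := by
    refine supermartingale_of_setIntegral_succ_le hVad hVi fun n s hs => ?_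
    have h1 : ∀ ω, V (n + 1) ω =
        D (n + 1) ω + (∑ m ∈ Finset.range (n + 1), Ψ m ω + e (n + 1)) := fun ω => by
      simp only [hV]; ring
    have h2 : ∀ ω, V n ω = (D n ω - Ψ n ω + η n) +
        (∑ m ∈ Finset.range (n + 1), Ψ m ω + e (n + 1)) := fun ω => by
      simp only [hV, Finset.sum_range_succ, hesucc]; ring
    have h3 : Integrable (fun ω => ∑ m ∈ Finset.range (n + 1), Ψ m ω + e (n + 1)) P :=
      (hsi _).add (integrable_const _)
    have h4 : Integrable (fun ω => D n ω - Ψ n ω + η n) P :=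
      ((hDi n).sub (hΨi n)).add (integrable_const _)
    simp only [h1, h2]
    rw [integral_add (hDi _).integrableOn h3.integrableOn,
      integral_add h4.integrableOn h3.integrableOn]
    exact add_le_add_left (hstep n s hs) _
  have hbound : ∀ n, ∫ ω, V n ω ∂P ≤ ∫ ω, V 0 ω ∂P := fun n => by
    have := hsuper.setIntegral_le (Nat.zero_le n) MeasurableSet.univ
    simpa using this
  refine ⟨⟨∫ ω, V 0 ω ∂P, fun n => (integral_mono (hDi n) (hVi n) fun ω => ?_).trans (hbound n)⟩, ?_⟩
  · have := hsum0 n ω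
    have := he0 n
    simp only [hV]; linarith
  -- Nonnegativity makes the `L¹` norm of `V n` its mean, so Doob's convergence theorem applies to
  -- `-V`.
  have hL1 : ∀ n, eLpNorm ((-V) n) 1 P ≤ (Real.toNNReal (∫ ω, V 0 ω ∂P) : ENNReal) := fun n => by
    rw [Pi.neg_apply, eLpNorm_neg, eLpNorm_one_eq_lintegral_enorm,
      ← ofReal_integral_norm_eq_lintegral_enorm (hVi n)]
    refine ENNReal.ofReal_le_ofReal ?_
    simpa only [Real.norm_of_nonneg (hV0 n _)] using hbound n
  filter_upwards [hsuper.neg.exists_ae_tendsto_of_bdd hL1] with ω ⟨c, hc⟩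
  have hc' : Tendsto (fun n => V n ω) atTop (𝓝 (-c)) := by simpa using hc.neg
  have hbdd : BddAbove (Set.range fun n => V n ω) := hc'.bddAbove_range
  obtain ⟨b, hb⟩ := hbdd
  have hsm : Summable fun n => Ψ n ω := by
    refine summable_of_sum_range_le (c := b) (fun n => hΨ0 n ω) fun n => ?_
    have h1 : V n ω ≤ b := hb ⟨n, rfl⟩
    have := hD0 n ω
    have := he0 n
    simp only [hV] at h1; linarith
  refine ⟨⟨_, ((hc'.sub hsm.hasSum.tendsto_sum_nat).sub helim).congr fun n => ?_⟩, hsm⟩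
  simp only [hV]; ring

/-! ### From almost sure to `L¹` convergence -/

/-- A sequence bounded in `L²` is uniformly integrable. -/
theorem unifIntegrable_one_of_lintegral_sq_le {Ω E : Type*} {mΩ : MeasurableSpace Ω}
    [NormedAddCommGroup E] {P : Measure Ω} {f : ℕ → Ω → E} {B : NNReal}
    (hf : ∀ n, AEStronglyMeasurable (f n) P) (hB : ∀ n, ∫⁻ ω, ‖f n ω‖ₑ ^ 2 ∂P ≤ B) :
    UnifIntegrable f 1 P := by
  refine unifIntegrable_of le_rfl ENNReal.one_ne_top hf fun ε hε => ?_
  -- Where `‖f‖ ≥ C` one has `‖f‖ ≤ ‖f‖² / C`, so the tail integral is at most `B / C ≤ ε`; the `+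
  -- 1` keeps `C` nonzero.
  set C : NNReal := B / ε.toNNReal + 1 with hC
  have hC0 : (C : ENNReal) ≠ 0 := by
    simp [hC]
  refine ⟨C, fun n => ?_⟩
  rw [eLpNorm_one_eq_lintegral_enorm]
  calc ∫⁻ ω, ‖{ω | C ≤ ‖f n ω‖₊}.indicator (f n) ω‖ₑ ∂P
      ≤ ∫⁻ ω, (C : ENNReal)⁻¹ * ‖f n ω‖ₑ ^ 2 ∂P := by
        refine lintegral_mono fun ω => ?_
        by_cases h : C ≤ ‖f n ω‖₊
        · rw [Set.indicator_of_mem (by exact h), ← ENNReal.div_eq_inv_mul,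
            ENNReal.le_div_iff_mul_le (Or.inl hC0) (Or.inl ENNReal.coe_ne_top), sq]
          gcongr
          exact ENNReal.coe_le_coe.2 h
        · rw [Set.indicator_of_notMem (by exact h)]
          simp
    _ = (C : ENNReal)⁻¹ * ∫⁻ ω, ‖f n ω‖ₑ ^ 2 ∂P :=
        lintegral_const_mul'' _ ((hf n).enorm.pow_const 2)
    _ ≤ (C : ENNReal)⁻¹ * B := by gcongr; exact hB n
    _ ≤ ENNReal.ofReal ε := by
        rw [← ENNReal.div_eq_inv_mul]
        refine ENNReal.div_le_of_le_mul ?_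
        rw [ENNReal.ofReal, ← ENNReal.coe_mul, ENNReal.coe_le_coe, hC, mul_add,
          mul_div_cancel₀ _ (by simpa using hε)]
        exact le_self_add

/-- Almost sure convergence of a sequence bounded in `L²` implies convergence in `L¹`. -/
theorem tendsto_eLpNorm_one_of_lintegral_sq_le {Ω E : Type*} {mΩ : MeasurableSpace Ω}
    [NormedAddCommGroup E] {P : Measure Ω} [IsFiniteMeasure P] {f : ℕ → Ω → E} {g : Ω → E}
    {B : NNReal} (hf : ∀ n, AEStronglyMeasurable (f n) P)
    (hB : ∀ n, ∫⁻ ω, ‖f n ω‖ₑ ^ 2 ∂P ≤ B)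
    (hfg : ∀ᵐ ω ∂P, Tendsto (fun n => f n ω) atTop (𝓝 (g ω))) :
    MemLp g 1 P ∧ Tendsto (fun n => eLpNorm (f n - g) 1 P) atTop (𝓝 0) := by
  have hg : MemLp g 1 P := by
    have hgm : AEStronglyMeasurable g P := aestronglyMeasurable_of_tendsto_ae _ hf hfg
    refine (MemLp.mono_exponent (q := 2) ⟨hgm, ?_⟩ (by norm_num) : MemLp g 1 P)
    have h2 : ∀ n, eLpNorm (f n) 2 P ≤ (B : ENNReal) ^ (1 / 2 : ℝ) := fun n => by
      rw [eLpNorm_eq_lintegral_rpow_enorm_toReal (by norm_num) (by norm_num)]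
      simp only [ENNReal.toReal_ofNat, ENNReal.rpow_ofNat]
      gcongr
      exact hB n
    refine (Lp.eLpNorm_lim_le_liminf_eLpNorm hf g hfg).trans_lt ?_
    refine lt_of_le_of_lt (liminf_le_of_le (by isBoundedDefault)
      (a := (B : ENNReal) ^ (1 / 2 : ℝ)) ?_) ?_
    · intro b hb
      obtain ⟨n, hn⟩ := hb.exists
      exact hn.trans (h2 n)
    · exact ENNReal.rpow_lt_top_of_nonneg (by norm_num) ENNReal.coe_ne_top
  exact ⟨hg, tendsto_Lp_finite_of_tendsto_ae le_rfl ENNReal.one_ne_top hf hg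
    (unifIntegrable_one_of_lintegral_sq_le hf hB) hfg⟩

/-! ### Deterministic convergence from Fejér-type monotonicity -/

/-- A sequence that is Fejér monotone up to errors with respect to the minimizers of `Φ`, along
which `Φ` is asymptotically minimized in the weighted summable sense, converges to a minimizer. -/
theorem exists_tendsto_isMinOn_of_summable {E : Type*} [PseudoMetricSpace E] [ProperSpace E]
    {Φ : E → ℝ} (hΦ : Continuous Φ) {S : Set E} (hSne : S.Nonempty)
    (hSmin : ∀ z ∈ S, IsMinOn Φ Set.univ z)
    (hSdense : {z | IsMinOn Φ Set.univ z} ⊆ closure S)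
    {γ : ℕ → ℝ} (hγ : ∀ n, 0 < γ n) (hγs : ¬ Summable γ) {x : ℕ → E}
    (hdist : ∀ z ∈ S, ∃ c, Tendsto (fun n => dist (x n) z) atTop (𝓝 c))
    (hsum : ∀ z ∈ S, Summable fun n => γ n * (Φ (x n) - Φ z)) :
    ∃ l, IsMinOn Φ Set.univ l ∧ Tendsto x atTop (𝓝 l) := by
  obtain ⟨z₀, hz₀⟩ := hSne
  -- Otherwise the gap eventually stays above `1 / (k + 1)`, and the summable series dominates a
  -- multiple of `∑ γ n`.
  have hfreq : ∀ k : ℕ, ∃ᶠ n in atTop, Φ (x n) < Φ z₀ + 1 / ((k : ℝ) + 1) := by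
    intro k hk
    have hε : (0 : ℝ) < 1 / ((k : ℝ) + 1) := by positivity
    refine hγs ?_
    have h1 : Summable fun n => γ n * (1 / ((k : ℝ) + 1)) := by
      refine summable_of_isBigO_nat (hsum z₀ hz₀) (Asymptotics.IsBigO.of_bound 1 ?_)
      filter_upwards [hk] with n hn
      rw [not_lt] at hn
      have h2 : γ n * (1 / ((k : ℝ) + 1)) ≤ γ n * (Φ (x n) - Φ z₀) :=
        mul_le_mul_of_nonneg_left (by linarith) (hγ n).le
      have h3 : 0 ≤ γ n * (1 / ((k : ℝ) + 1)) := mul_nonneg (hγ n).le hε.le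
      rw [Real.norm_of_nonneg h3, Real.norm_of_nonneg (h3.trans h2), one_mul]
      exact h2
    exact (summable_mul_right_iff hε.ne').1 h1
  obtain ⟨σ, hσ, hσΦ⟩ := extraction_forall_of_frequently hfreq
  have hbdd : Bornology.IsBounded (Set.range x) := by
    obtain ⟨c, hc⟩ := hdist z₀ hz₀
    obtain ⟨b, hb⟩ := hc.bddAbove_range
    refine (Metric.isBounded_closedBall (x := z₀) (r := b)).subset ?_
    rintro _ ⟨n, rfl⟩
    exact hb ⟨n, rfl⟩
  obtain ⟨l, -, τ, hτ, hl⟩ :=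
    tendsto_subseq_of_bounded hbdd (x := x ∘ σ) fun n => Set.mem_range_self _
  have hΦl : Φ l ≤ Φ z₀ := by
    have h1 : Tendsto (fun n => Φ z₀ + 1 / (((τ n : ℕ) : ℝ) + 1)) atTop (𝓝 (Φ z₀)) := by
      simpa using (tendsto_one_div_add_atTop_nhds_zero_nat (𝕜 := ℝ)).comp
        hτ.tendsto_atTop |>.const_add (Φ z₀)
    exact le_of_tendsto_of_tendsto' ((hΦ.tendsto l).comp hl) h1 fun n => (hσΦ (τ n)).le
  have hlmin : IsMinOn Φ Set.univ l := fun y hy => hΦl.trans (hSmin z₀ hz₀ hy)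
  refine ⟨l, hlmin, Metric.tendsto_atTop'.2 fun ε hε => ?_⟩
  -- `l` need not lie in `S`, so its distances to `x n` are controlled through a nearby `z ∈ S`; the
  -- limit of `dist (x n) z` is identified along the subsequence.
  obtain ⟨z, hz, hlz⟩ := Metric.mem_closure_iff.1 (hSdense hlmin) (ε / 2) (half_pos hε)
  obtain ⟨c, hc⟩ := hdist z hz
  have hc' : Tendsto (fun n => dist (x (σ (τ n))) z) atTop (𝓝 (dist l z)) :=
    hl.dist tendsto_const_nhds
  have hcl : c = dist l z :=
    tendsto_nhds_unique (hc.comp (hσ.tendsto_atTop.comp hτ.tendsto_atTop)) hc'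
  obtain ⟨n₀, hn₀⟩ := eventually_atTop.1 (hc.eventually_lt_const (hcl ▸ hlz))
  refine ⟨n₀, fun n hn => (dist_triangle_right _ _ z).trans_lt ?_⟩
  linarith [hn₀ n hn.le]

/-! ### Random sampling and the abstract stochastic scheme -/

/-- Averaging over an index that is independent of the integrands and of the domain. -/
theorem setIntegral_comp_indep {Ω K : Type*} {m mΩ : MeasurableSpace Ω} {P : Measure Ω}
    [IsFiniteMeasure P] [Fintype K] [MeasurableSpace K] [MeasurableSingletonClass K]
    (hm : m ≤ mΩ) {κ : Ω → K} (hκ : Measurable κ)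
    (hind : Indep (MeasurableSpace.comap κ inferInstance) m P)
    {h : K → Ω → ℝ} (hh : ∀ k, StronglyMeasurable[m] (h k)) (hi : ∀ k, Integrable (h k) P)
    {s : Set Ω} (hs : MeasurableSet[m] s) :
    Integrable (fun ω => h (κ ω) ω) P ∧
    ∫ ω in s, h (κ ω) ω ∂P = ∑ k, P.real (κ ⁻¹' {k}) * ∫ ω in s, h k ω ∂P := by
  classical
  have hpre : ∀ k, MeasurableSet (κ ⁻¹' {k}) := fun k => hκ (measurableSet_singleton k)
  have hdec : ∀ ω, h (κ ω) ω = ∑ k, (κ ⁻¹' {k}).indicator (h k) ω := fun ω => by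
    rw [Finset.sum_eq_single (κ ω)]
    · rw [Set.indicator_of_mem (by simp)]
    · intro k _ hk
      exact Set.indicator_of_notMem (by simpa using hk.symm) _
    · simp
  have hint : ∀ k, Integrable ((κ ⁻¹' {k}).indicator (h k)) P := fun k => (hi k).indicator (hpre k)
  simp only [hdec]
  refine ⟨integrable_finsetSum _ fun k _ => hint k, ?_⟩
  rw [integral_finsetSum _ fun k _ => (hint k).integrableOn]
  refine Finset.sum_congr rfl fun k _ => ?_
  rw [← integral_indicator (hm _ hs), ← integral_indicator (hm _ hs)]
  -- The first factor depends only on `κ`, the second is `m`-measurable, so the integral of the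
  -- product factors.
  have h1 : ∀ ω, s.indicator ((κ ⁻¹' {k}).indicator (h k)) ω =
      (κ ⁻¹' {k}).indicator (fun _ => (1 : ℝ)) ω * s.indicator (h k) ω := fun ω => by
    by_cases h1 : ω ∈ s <;> by_cases h2 : ω ∈ κ ⁻¹' {k} <;> simp [h1, h2]
  have hmeas : StronglyMeasurable[m] (s.indicator (h k)) := (hh k).indicator hs
  have hindf : IndepFun ((κ ⁻¹' {k}).indicator fun _ => (1 : ℝ)) (s.indicator (h k)) P := by
    refine indep_of_indep_of_le_left (indep_of_indep_of_le_right hind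
      hmeas.measurable.comap_le) ?_
    refine Measurable.comap_le (Measurable.indicator (m := MeasurableSpace.comap κ inferInstance)
      measurable_const ?_)
    exact ⟨{k}, measurableSet_singleton k, rfl⟩
  have hmul := hindf.integral_fun_mul_eq_mul_integral
    (stronglyMeasurable_const.indicator (hpre k)).aestronglyMeasurable
    (hmeas.mono hm).aestronglyMeasurable
  calc _ = ∫ ω, (κ ⁻¹' {k}).indicator (fun _ => (1 : ℝ)) ω * s.indicator (h k) ω ∂P :=
        integral_congr_ae (ae_of_all _ h1)
    _ = _ := by rw [hmul, integral_indicator_const _ (hpre k)]; simp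

/-- Convergence of a stochastic descent scheme in which a uniformly sampled term of the average `Φ`
drives each step. -/
theorem random_descent {Ω E K : Type*} {mΩ : MeasurableSpace Ω} {P : Measure Ω}
    [IsProbabilityMeasure P] [NormedAddCommGroup E] [ProperSpace E] [MeasurableSpace E]
    [BorelSpace E] [Fintype K] [MeasurableSpace K] [MeasurableSingletonClass K]
    {φ : K → E → ℝ} (hφ : ∀ k, Continuous (φ k)) (hφ0 : ∀ k x, 0 ≤ φ k x)
    {C : ℝ} (hφC : ∀ k x, φ k x ≤ C * (1 + ‖x‖ ^ 2))
    {Φ : E → ℝ} (hΦ : ∀ x, Φ x = ∑ k, (Fintype.card K : ℝ)⁻¹ * φ k x)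
    (hZ : {z | IsMinOn Φ Set.univ z}.Nonempty)
    {γ : ℕ → ℝ} (hγ : ∀ n, 0 < γ n) (hγs : ¬ Summable γ) (hγ2 : Summable fun n => γ n ^ 2)
    {ℱ : Filtration ℕ mΩ} {x : ℕ → Ω → E} (hx : StronglyAdapted ℱ x) (hx0 : MemLp (x 0) 2 P)
    {κ : ℕ → Ω → K} (hκ : ∀ n, Measurable (κ n))
    (hunif : ∀ n k, P.real (κ n ⁻¹' {k}) = (Fintype.card K : ℝ)⁻¹)
    (hind : ∀ n, Indep (MeasurableSpace.comap (κ n) inferInstance) (ℱ n) P)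
    {M : ℝ} (hM : 0 ≤ M)
    (hstep : ∀ z n, ∀ᵐ ω ∂P, ‖x (n + 1) ω - z‖ ^ 2 ≤
      ‖x n ω - z‖ ^ 2 - 2 * γ n * (φ (κ n ω) (x n ω) - φ (κ n ω) z) + M * γ n ^ 2) :
    ∃ y : Ω → E, Measurable y ∧ (∀ ω, y ω ∈ {z | IsMinOn Φ Set.univ z}) ∧
      (∀ᵐ ω ∂P, Tendsto (fun n => x n ω) atTop (𝓝 (y ω))) ∧
      (∀ n, MemLp (x n) 1 P) ∧ MemLp y 1 P ∧
      Tendsto (fun n => eLpNorm (x n - y) 1 P) atTop (𝓝 0) := by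
  have hΦc : Continuous Φ := by
    rw [funext hΦ]
    exact continuous_finsetSum _ fun k _ => (hφ k).const_mul _
  have hxm : ∀ n, StronglyMeasurable (x n) := fun n => (hx n).mono (ℱ.le n)
  have hφi : ∀ n, MemLp (x n) 2 P → ∀ k, Integrable (fun ω => φ k (x n ω)) P := by
    intro n hn k
    refine Integrable.mono' (g := fun ω => C * (1 + ‖x n ω‖ ^ 2))
      (((integrable_const _).add hn.norm.integrable_sq).const_mul _)
      ((hφ k).comp_stronglyMeasurable (hxm n)).aestronglyMeasurable (ae_of_all _ fun ω => ?_)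
    rw [Real.norm_of_nonneg (hφ0 _ _)]
    exact hφC _ _
  have hsq : ∀ n, MemLp (x n) 2 P → ∀ z, Integrable (fun ω => ‖x n ω - z‖ ^ 2) P :=
    fun n hn z => (hn.sub (memLp_const z)).norm.integrable_sq
  have hx2 : ∀ n, MemLp (x n) 2 P := by
    intro n
    induction n with
    | zero => exact hx0
    | succ n ih =>
      have h1 : Integrable (fun ω => ‖x (n + 1) ω‖ ^ 2) P := by
        -- The step inequality at `z = 0`, with `φ ≥ 0` and `φ k 0 ≤ C`. Only square integrability
        -- is sought here; a bound uniform in `n` comes from `hmain`.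
        refine Integrable.mono' (g := fun ω => ‖x n ω - 0‖ ^ 2 + (2 * γ n * C + M * γ n ^ 2))
          ((hsq n ih 0).add (integrable_const _)) ((hxm _).norm.pow 2).aestronglyMeasurable ?_
        filter_upwards [hstep 0 n] with ω hω
        rw [Real.norm_of_nonneg (by positivity)]
        rw [sub_zero] at hω
        have h2 : φ (κ n ω) 0 ≤ C := by simpa using hφC (κ n ω) 0
        have h3 := mul_le_mul_of_nonneg_left (sub_le_sub h2 (hφ0 (κ n ω) (x n ω)))
          (mul_nonneg zero_le_two (hγ n).le)
        linarith
      exact (memLp_two_iff_integrable_sq_norm (hxm _).aestronglyMeasurable).2 h1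
  have hΦi : ∀ n, Integrable (fun ω => Φ (x n ω)) P := fun n => by
    simp only [hΦ]
    exact integrable_finsetSum _ fun k _ => (hφi n (hx2 n) k).const_mul _
  have hmain : ∀ z, IsMinOn Φ Set.univ z →
      (∃ B, ∀ n, ∫ ω, ‖x n ω - z‖ ^ 2 ∂P ≤ B) ∧
      ∀ᵐ ω ∂P, (∃ c, Tendsto (fun n => ‖x n ω - z‖ ^ 2) atTop (𝓝 c)) ∧
        Summable fun n => 2 * γ n * (Φ (x n ω) - Φ z) := by
    intro z hz
    refine robbins_siegmund (ℱ := ℱ) (D := fun n ω => ‖x n ω - z‖ ^ 2)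
      (Ψ := fun n ω => 2 * γ n * (Φ (x n ω) - Φ z)) (η := fun n => M * γ n ^ 2)
      (fun n => ((hx n).sub stronglyMeasurable_const).norm.pow 2)
      (fun n => ((hΦc.comp_stronglyMeasurable (hx n)).sub stronglyMeasurable_const).const_mul _)
      (fun n => hsq n (hx2 n) z)
      (fun n => ((hΦi n).sub (integrable_const _)).const_mul _)
      (fun n ω => by positivity)
      (fun n ω => mul_nonneg (mul_nonneg zero_le_two (hγ n).le)
        (sub_nonneg.2 (hz (Set.mem_univ _))))
      (fun n => by positivity) (hγ2.mul_left M) fun n s hs => ?_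
    obtain ⟨hi1, hi2⟩ := setIntegral_comp_indep (ℱ.le n) (hκ n) (hind n)
      (h := fun k ω => φ k (x n ω) - φ k z)
      (fun k => ((hφ k).comp_stronglyMeasurable (hx n)).sub stronglyMeasurable_const)
      (fun k => (hφi n (hx2 n) k).sub (integrable_const _)) hs
    have hi3 : ∫ ω in s, (φ (κ n ω) (x n ω) - φ (κ n ω) z) ∂P =
        ∫ ω in s, (Φ (x n ω) - Φ z) ∂P := by
      rw [hi2]
      simp only [hunif, hΦ, ← Finset.sum_sub_distrib, ← mul_sub]
      have hi4 : ∀ k, Integrable (fun ω => φ k (x n ω) - φ k z) P :=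
        fun k => (hφi n (hx2 n) k).sub (integrable_const _)
      rw [integral_finsetSum _ fun k _ => ((hi4 k).const_mul _).integrableOn]
      simp only [integral_const_mul]
    have haux : ∀ G : Ω → ℝ, Integrable G P →
        IntegrableOn (fun ω => ‖x n ω - z‖ ^ 2 - 2 * γ n * G ω + M * γ n ^ 2) s P ∧
        ∫ ω in s, (‖x n ω - z‖ ^ 2 - 2 * γ n * G ω + M * γ n ^ 2) ∂P =
          ∫ ω in s, ‖x n ω - z‖ ^ 2 ∂P - 2 * γ n * ∫ ω in s, G ω ∂P +
            ∫ _ in s, M * γ n ^ 2 ∂P := fun G hG => by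
      have hd := (hsq n (hx2 n) z).integrableOn (s := s)
      have hG' := (hG.const_mul (2 * γ n)).integrableOn (s := s)
      have hdG : IntegrableOn (fun ω => ‖x n ω - z‖ ^ 2 - 2 * γ n * G ω) s P := hd.sub hG'
      have hc : IntegrableOn (fun _ : Ω => M * γ n ^ 2) s P := integrableOn_const
      refine ⟨hdG.add hc, ?_⟩
      rw [integral_add hdG hc, integral_sub hd hG', integral_const_mul]
    obtain ⟨h1, h2⟩ := haux _ hi1
    obtain ⟨-, h3⟩ := haux (fun ω => Φ (x n ω) - Φ z) ((hΦi n).sub (integrable_const _))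
    refine (integral_mono_ae (hsq _ (hx2 _) z).integrableOn h1
      (ae_restrict_of_ae (hstep z n))).trans_eq ?_
    rw [h2, h3, hi3]
  -- The null set in `hmain` depends on `z`; a countable dense set of minimizers leaves a single
  -- null set.
  obtain ⟨S, hSZ, hSc, hSd⟩ := (TopologicalSpace.IsSeparable.of_separableSpace
    {z | IsMinOn Φ Set.univ z}).exists_countable_dense_subset
  have hSne : S.Nonempty := by
    rw [← closure_nonempty_iff]
    exact hZ.mono hSd
  have hae : ∀ᵐ ω ∂P, ∃ l, IsMinOn Φ Set.univ l ∧ Tendsto (fun n => x n ω) atTop (𝓝 l) := by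
    filter_upwards [(ae_ball_iff hSc).2 fun z hz => (hmain z (hSZ hz)).2] with ω hω
    refine exists_tendsto_isMinOn_of_summable hΦc hSne hSZ hSd hγ hγs (fun z hz => ?_)
      fun z hz => ?_
    · obtain ⟨c, hc⟩ := (hω z hz).1
      refine ⟨√c, ((Real.continuous_sqrt.tendsto c).comp hc).congr fun n => ?_⟩
      simp [dist_eq_norm]
    · refine ((hω z hz).2.mul_left (1 / 2)).congr fun n => ?_
      ring
  obtain ⟨f, hfm, hf⟩ := measurable_limit_of_tendsto_metrizable_ae
    (fun n => (hxm n).measurable.aemeasurable) (hae.mono fun ω ⟨l, _, hl⟩ => ⟨l, hl⟩)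
  have hZcl : IsClosed {z | IsMinOn Φ Set.univ z} := by
    have : {z | IsMinOn Φ Set.univ z} = ⋂ y, {z | Φ z ≤ Φ y} := by
      ext z; simp [isMinOn_univ_iff]
    rw [this]
    exact isClosed_iInter fun y => isClosed_le hΦc continuous_const
  obtain ⟨z₀, hz₀⟩ := hZ
  classical
  -- Redefined off the good event so that every value, not just almost every one, is a minimizer.
  set y : Ω → E := (f ⁻¹' {z | IsMinOn Φ Set.univ z}).piecewise f fun _ => z₀ with hy
  have hyt : ∀ᵐ ω ∂P, Tendsto (fun n => x n ω) atTop (𝓝 (y ω)) := by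
    filter_upwards [hae, hf] with ω ⟨l, hl, hlt⟩ hω
    obtain rfl := tendsto_nhds_unique hω hlt
    rwa [hy, Set.piecewise_eq_of_mem _ _ _ (by exact hl)]
  obtain ⟨B, hB⟩ := (hmain z₀ hz₀).1
  have hB' : ∀ n, ∫⁻ ω, ‖x n ω - z₀‖ₑ ^ 2 ∂P ≤ (B.toNNReal : ENNReal) := fun n => by
    have h1 : ∀ ω, ‖x n ω - z₀‖ₑ ^ 2 = ENNReal.ofReal (‖x n ω - z₀‖ ^ 2) := fun ω => by
      rw [ENNReal.ofReal_pow (norm_nonneg _), ofReal_norm]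
    simp only [h1]
    rw [← ofReal_integral_eq_lintegral_ofReal (hsq n (hx2 n) z₀)
      (ae_of_all _ fun ω => by positivity)]
    exact ENNReal.ofReal_le_ofReal (hB n)
  obtain ⟨hg, hlim⟩ := tendsto_eLpNorm_one_of_lintegral_sq_le (f := fun n ω => x n ω - z₀)
    (g := fun ω => y ω - z₀) (fun n => ((hxm n).sub stronglyMeasurable_const).aestronglyMeasurable)
    hB' (hyt.mono fun ω hω => hω.sub_const z₀)
  refine ⟨y, hfm.piecewise (hfm hZcl.measurableSet) measurable_const, fun ω => ?_, hyt,
    fun n => (hx2 n).mono_exponent (by norm_num), ?_, hlim.congr fun n => ?_⟩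
  · by_cases h : ω ∈ f ⁻¹' {z | IsMinOn Φ Set.univ z}
    · rw [hy, Set.piecewise_eq_of_mem _ _ _ h]; exact h
    · rw [hy, Set.piecewise_eq_of_notMem _ _ _ h]; exact hz₀
  · have h1 : y = (fun ω => y ω - z₀) + fun _ => z₀ := by ext; simp
    rw [h1]
    exact hg.add (memLp_const z₀)
  · congr 1
    ext ω
    simp

variable {N : ℕ}

/-! ### The proximal-gradient step -/

/-- The defining variational inequality of the proximal point of a convex function. -/
theorem IsProxPoint.add_sq_le {h : EuclideanSpace ℝ (Fin N) → ℝ} (hconv : ConvexOn ℝ Set.univ h)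
    {y p : EuclideanSpace ℝ (Fin N)} (hp : IsProxPoint h y p) (z : EuclideanSpace ℝ (Fin N)) :
    2 * h p + ‖y - p‖ ^ 2 + ‖p - z‖ ^ 2 ≤ 2 * h z + ‖y - z‖ ^ 2 := by
  -- Compare `p` with the point `(1 - t) p + t z` of the segment, divide by `t`, then let `t → 0`.
  have hvar : ∀ t ∈ Set.Ioo (0 : ℝ) 1,
      h p - h z + inner ℝ (y - p) (z - p) ≤ t / 2 * ‖z - p‖ ^ 2 := by
    rintro t ⟨ht0, ht1⟩
    have h1 : h p + 1 / 2 * ‖y - p‖ ^ 2 ≤ h ((1 - t) • p + t • z) +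
        1 / 2 * ‖y - ((1 - t) • p + t • z)‖ ^ 2 := hp (Set.mem_univ _)
    have h2 := hconv.2 (Set.mem_univ p) (Set.mem_univ z) (sub_nonneg.2 ht1.le) ht0.le (by ring)
    have h3 : y - ((1 - t) • p + t • z) = (y - p) - t • (z - p) := by module
    rw [h3, norm_sub_sq_real (y - p), real_inner_smul_right, norm_smul, mul_pow, Real.norm_eq_abs,
      sq_abs] at h1
    simp only [smul_eq_mul] at h2
    refine le_of_mul_le_mul_left ?_ ht0
    nlinarith
  have hlim : Tendsto (fun t : ℝ => t / 2 * ‖z - p‖ ^ 2) (𝓝[>] 0) (𝓝 0) := by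
    have h1 : Continuous fun t : ℝ => t / 2 * ‖z - p‖ ^ 2 := by fun_prop
    simpa using (h1.tendsto 0).mono_left nhdsWithin_le_nhds
  have hle : h p - h z + inner ℝ (y - p) (z - p) ≤ 0 :=
    ge_of_tendsto hlim (by
      filter_upwards [Ioo_mem_nhdsGT (zero_lt_one' ℝ)] with t ht using hvar t ht)
  have h4 : y - z = (y - p) - (z - p) := by abel
  rw [h4, norm_sub_sq_real (y - p), norm_sub_rev p z]
  linarith

/-- One proximal-gradient step on `f + g` for a Lipschitz `f` and a bounded subgradient of `g`. -/
theorem norm_proxGradient_sub_sq_le {f g : EuclideanSpace ℝ (Fin N) → ℝ}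
    (hf : ConvexOn ℝ Set.univ f) {A B γ : ℝ} (hγ : 0 ≤ γ) (hA : 0 ≤ A)
    (hfA : ∀ x y, f x - f y ≤ A * ‖x - y‖) {x v p : EuclideanSpace ℝ (Fin N)} (hv : ‖v‖ ≤ B)
    (hg : ∀ z, g x + inner ℝ v (z - x) ≤ g z)
    (hp : IsProxPoint (fun z => γ * f z) (x - γ • v) p) (z : EuclideanSpace ℝ (Fin N)) :
    ‖p - z‖ ^ 2 ≤ ‖x - z‖ ^ 2 - 2 * γ * ((f x + g x) - (f z + g z)) + (A + B) ^ 2 * γ ^ 2 := by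
  have h1 : 2 * (γ * f p) + ‖x - γ • v - p‖ ^ 2 + ‖p - z‖ ^ 2 ≤
      2 * (γ * f z) + ‖x - γ • v - z‖ ^ 2 := hp.add_sq_le (hf.smul hγ) z
  have h2 : ‖x - γ • v - z‖ ^ 2 =
      ‖x - z‖ ^ 2 + 2 * γ * inner ℝ v (z - x) + γ ^ 2 * ‖v‖ ^ 2 := by
    have e : x - γ • v - z = (x - z) - γ • v := by abel
    rw [e, norm_sub_sq_real, real_inner_smul_right, norm_smul, mul_pow, Real.norm_eq_abs, sq_abs,
      ← neg_sub z x, inner_neg_left, norm_neg, real_inner_comm]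
    ring
  have h3 : ‖x - p‖ ≤ ‖x - γ • v - p‖ + γ * B := by
    have e : x - p = (x - γ • v - p) + γ • v := by abel
    rw [e]
    refine (norm_add_le _ _).trans (add_le_add le_rfl ?_)
    rw [norm_smul, Real.norm_of_nonneg hγ]
    gcongr
  have h4 := mul_le_mul_of_nonneg_left ((hfA x p).trans (mul_le_mul_of_nonneg_left h3 hA)) hγ
  have h5 := mul_le_mul_of_nonneg_left (hg z) hγ
  have h6 : ‖v‖ ^ 2 ≤ B ^ 2 := by gcongr
  have h7 := mul_le_mul_of_nonneg_left h6 (sq_nonneg γ)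
  -- With `r = ‖x - γ • v - p‖`, the square gives `2γAr - r² ≤ γ²A²`; adding `2γ²AB` and `γ²B²`
  -- produces `(A + B)² γ²`.
  nlinarith [sq_nonneg (‖x - γ • v - p‖ - γ * A)]

/-! ### Estimates for the two losses -/

theorem hingeLoss_nonneg {α : ℝ} (hα : 0 ≤ α) (u : EuclideanSpace ℝ (Fin N)) (ξ : ℝ)
    (x : EuclideanSpace ℝ (Fin N)) : 0 ≤ hingeLoss α u ξ x :=
  mul_nonneg hα (le_max_left _ _)

theorem continuous_hingeLoss (α : ℝ) (u : EuclideanSpace ℝ (Fin N)) (ξ : ℝ) :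
    Continuous (hingeLoss α u ξ) := by
  unfold hingeLoss
  fun_prop

theorem hingeLoss_sub_le {α : ℝ} (hα : 0 ≤ α) (u : EuclideanSpace ℝ (Fin N)) {ξ : ℝ}
    (hξ : |ξ| = 1) (x y : EuclideanSpace ℝ (Fin N)) :
    hingeLoss α u ξ x - hingeLoss α u ξ y ≤ α * ‖u‖ * ‖x - y‖ := by
  have h1 : -(ξ * inner ℝ (x - y) u) ≤ ‖x - y‖ * ‖u‖ := by
    refine (neg_le_abs _).trans ?_
    rw [abs_mul, hξ, one_mul]
    exact abs_real_inner_le_norm _ _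
  rw [inner_sub_left] at h1
  have h2 : max 0 (1 - ξ * inner ℝ x u) ≤ max 0 (1 - ξ * inner ℝ y u) + ‖x - y‖ * ‖u‖ := by
    refine max_le (by positivity) ?_
    linarith [le_max_right 0 (1 - ξ * inner ℝ y u)]
  have h3 := mul_le_mul_of_nonneg_left h2 hα
  unfold hingeLoss
  linarith

/-- The graph of `t ↦ log (1 + exp t)` lies above its tangents. -/
theorem log_one_add_exp_tangent_le (s t : ℝ) :
    Real.log (1 + Real.exp t) + Real.exp t / (1 + Real.exp t) * (s - t) ≤
      Real.log (1 + Real.exp s) := by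
  have ht : 0 < 1 + Real.exp t := by positivity
  have hs : 0 < 1 + Real.exp s := by positivity
  -- Jensen for `exp` at `0` and `s - t` with weights `1 / (1 + exp t)` and `exp t / (1 + exp t)`;
  -- taking logarithms gives the tangent bound.
  have hconv := convexOn_exp.2 (Set.mem_univ 0) (Set.mem_univ (s - t))
    (by positivity : 0 ≤ 1 / (1 + Real.exp t))
    (by positivity : 0 ≤ Real.exp t / (1 + Real.exp t)) (by field_simp)
  simp only [smul_eq_mul, mul_zero, zero_add, Real.exp_zero, mul_one] at hconv
  have h1 : 1 / (1 + Real.exp t) + Real.exp t / (1 + Real.exp t) * Real.exp (s - t) =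
      (1 + Real.exp s) / (1 + Real.exp t) := by
    rw [Real.exp_sub]
    field_simp
  rw [h1, ← Real.le_log_iff_exp_le (by positivity), Real.log_div hs.ne' ht.ne'] at hconv
  linarith

theorem logisticLoss_nonneg {α : ℝ} (hα : α ≤ 1) (u : EuclideanSpace ℝ (Fin N)) (ξ : ℝ)
    (x : EuclideanSpace ℝ (Fin N)) : 0 ≤ logisticLoss α u ξ x :=
  mul_nonneg (sub_nonneg.2 hα) (Real.log_nonneg (by linarith [Real.exp_pos (-ξ * inner ℝ x u)]))

theorem hasGradientAt_logisticLoss (α : ℝ) (u : EuclideanSpace ℝ (Fin N)) (ξ : ℝ)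
    (x : EuclideanSpace ℝ (Fin N)) :
    HasGradientAt (logisticLoss α u ξ)
      (((1 - α) * (Real.exp (-ξ * inner ℝ x u) / (1 + Real.exp (-ξ * inner ℝ x u)) * -ξ)) • u)
      x := by
  have h1 : HasFDerivAt (fun z : EuclideanSpace ℝ (Fin N) => inner ℝ z u) (innerSL ℝ u) x := by
    refine (innerSL ℝ u).hasFDerivAt.congr_of_eventuallyEq (Eventually.of_forall fun z => ?_)
    exact real_inner_comm u z
  have h2 : HasDerivAt (fun r : ℝ => (1 - α) * Real.log (1 + Real.exp (-ξ * r)))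
      ((1 - α) * (Real.exp (-ξ * inner ℝ x u) / (1 + Real.exp (-ξ * inner ℝ x u)) * -ξ))
      (inner ℝ x u) := by
    have h3 : HasDerivAt (fun r : ℝ => 1 + Real.exp (-ξ * r))
        (Real.exp (-ξ * inner ℝ x u) * -ξ) (inner ℝ x u) := by
      simpa using (((hasDerivAt_id (inner ℝ x u)).const_mul (-ξ)).exp).const_add 1
    convert! (h3.log (by positivity)).const_mul (1 - α) using 1
    ring
  rw [hasGradientAt_iff_hasFDerivAt]
  convert! h2.comp_hasFDerivAt x h1 using 1
  ext z
  simp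

theorem continuous_logisticLoss (α : ℝ) (u : EuclideanSpace ℝ (Fin N)) (ξ : ℝ) :
    Continuous (logisticLoss α u ξ) :=
  continuous_iff_continuousAt.2 fun x =>
    (hasGradientAt_logisticLoss α u ξ x).hasFDerivAt.continuousAt

theorem norm_gradient_logisticLoss_le {α : ℝ} (hα : α ≤ 1) (u : EuclideanSpace ℝ (Fin N)) {ξ : ℝ}
    (hξ : |ξ| = 1) (x : EuclideanSpace ℝ (Fin N)) :
    ‖gradient (logisticLoss α u ξ) x‖ ≤ (1 - α) * ‖u‖ := by
  rw [(hasGradientAt_logisticLoss α u ξ x).gradient, norm_smul, Real.norm_eq_abs, abs_mul,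
    abs_mul, abs_neg, hξ, mul_one, abs_of_nonneg (sub_nonneg.2 hα), abs_of_nonneg (by positivity)]
  refine mul_le_mul_of_nonneg_right ?_ (norm_nonneg u)
  refine mul_le_of_le_one_right (sub_nonneg.2 hα) ?_
  rw [div_le_one (by positivity)]
  linarith

theorem logisticLoss_add_inner_gradient_le {α : ℝ} (hα : α ≤ 1) (u : EuclideanSpace ℝ (Fin N))
    (ξ : ℝ) (x z : EuclideanSpace ℝ (Fin N)) :
    logisticLoss α u ξ x + inner ℝ (gradient (logisticLoss α u ξ) x) (z - x) ≤
      logisticLoss α u ξ z := by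
  rw [(hasGradientAt_logisticLoss α u ξ x).gradient, real_inner_smul_left, inner_sub_right,
    real_inner_comm z u, real_inner_comm x u]
  have := mul_le_mul_of_nonneg_left
    (log_one_add_exp_tangent_le (-ξ * inner ℝ z u) (-ξ * inner ℝ x u)) (sub_nonneg.2 hα)
  unfold logisticLoss
  linarith

/-- At the origin the sum is at most `α + (1 - α) = 1`, since `log 2 ≤ 1`, and it grows with slope
at most `α‖u‖ + (1 - α)‖v‖ ≤ U`. This is the growth bound that makes the losses integrable along
square-integrable iterates. -/
theorem hingeLoss_add_logisticLoss_le {α : ℝ} (hα0 : 0 ≤ α) (hα1 : α ≤ 1)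
    {u v : EuclideanSpace ℝ (Fin N)} {ξ ζ : ℝ} (hξ : |ξ| = 1) (hζ : |ζ| = 1) {U : ℝ}
    (hu : ‖u‖ ≤ U) (hv : ‖v‖ ≤ U) (x : EuclideanSpace ℝ (Fin N)) :
    hingeLoss α u ξ x + logisticLoss α v ζ x ≤ (1 + U) * (1 + ‖x‖ ^ 2) := by
  have h1 := hingeLoss_sub_le hα0 u hξ x 0
  have h2 := logisticLoss_add_inner_gradient_le hα1 v ζ x 0
  have h3 := (neg_le_abs _).trans
    (abs_real_inner_le_norm (gradient (logisticLoss α v ζ) x) (0 - x))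
  have h4 := norm_gradient_logisticLoss_le hα1 v hζ x
  have h5 : hingeLoss α u ξ 0 = α := by simp [hingeLoss]
  have h6 : logisticLoss α v ζ 0 ≤ 1 - α := by
    have : Real.log (1 + 1) ≤ 1 := by
      linarith [Real.log_le_sub_one_of_pos (x := 1 + 1) (by norm_num)]
    simpa [logisticLoss] using mul_le_mul_of_nonneg_left this (sub_nonneg.2 hα1)
  rw [sub_zero] at h1
  rw [zero_sub, norm_neg] at h3
  rw [zero_sub] at h2
  have h7 := mul_le_mul_of_nonneg_right h4 (norm_nonneg x)
  have h8 : α * ‖u‖ + (1 - α) * ‖v‖ ≤ U := by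
    have := mul_le_mul_of_nonneg_left hu hα0
    have := mul_le_mul_of_nonneg_left hv (sub_nonneg.2 hα1)
    linarith
  have h9 := mul_le_mul_of_nonneg_right h8 (norm_nonneg x)
  have hU : 0 ≤ U := (norm_nonneg u).trans hu
  have h10 : U * ‖x‖ ≤ U * (1 + ‖x‖ ^ 2) :=
    mul_le_mul_of_nonneg_left (by nlinarith [sq_nonneg (‖x‖ - 1)]) hU
  nlinarith [sq_nonneg ‖x‖]

/-! ### Fitting the problem to the abstract scheme -/

theorem objective_eq_sum_prod {K₁ K₂ : Type*} [Fintype K₁] [Fintype K₂] [Nonempty K₁]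
    [Nonempty K₂] (α : ℝ) (u₁ : K₁ → EuclideanSpace ℝ (Fin N)) (ξ₁ : K₁ → ℝ)
    (u₂ : K₂ → EuclideanSpace ℝ (Fin N)) (ξ₂ : K₂ → ℝ) (x : EuclideanSpace ℝ (Fin N)) :
    objective α u₁ ξ₁ u₂ ξ₂ x = ∑ k : K₁ × K₂, (Fintype.card (K₁ × K₂) : ℝ)⁻¹ *
      (hingeLoss α (u₁ k.1) (ξ₁ k.1) x + logisticLoss α (u₂ k.2) (ξ₂ k.2) x) := by
  have h1 : (Fintype.card K₁ : ℝ) ≠ 0 := by simp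
  have h2 : (Fintype.card K₂ : ℝ) ≠ 0 := by simp
  rw [← Finset.mul_sum, Finset.sum_add_distrib, Fintype.sum_prod_type, Fintype.sum_prod_type]
  simp only [Finset.sum_const, Finset.card_univ, Fintype.card_prod, nsmul_eq_mul, ← Finset.mul_sum,
    Nat.cast_mul, objective]
  field_simp

/-- The filtration generated by the past `(x₀, …, xₙ)` of a sequence. -/
def pastFiltration {Ω E : Type*} {mΩ : MeasurableSpace Ω} [MeasurableSpace E] (x : ℕ → Ω → E)
    (hx : ∀ n, Measurable (x n)) : Filtration ℕ mΩ where
  seq n := MeasurableSpace.comap (fun ω (m : Fin (n + 1)) => x m ω) inferInstance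
  mono' n n' hn := by
    have h1 : (fun ω (m : Fin (n + 1)) => x m ω) =
        (fun (v : Fin (n' + 1) → E) (m : Fin (n + 1)) => v (Fin.castLE (by omega) m)) ∘
          fun ω (m : Fin (n' + 1)) => x m ω := rfl
    beta_reduce
    rw [h1, ← MeasurableSpace.comap_comp]
    exact MeasurableSpace.comap_mono (Measurable.comap_le (by fun_prop))
  le' n := (measurable_pi_lambda _ fun m : Fin (n + 1) => hx m).comap_le

theorem stronglyAdapted_pastFiltration {Ω E : Type*} {mΩ : MeasurableSpace Ω}
    [TopologicalSpace E] [TopologicalSpace.PseudoMetrizableSpace E] [SecondCountableTopology E]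
    [MeasurableSpace E] [BorelSpace E] (x : ℕ → Ω → E) (hx : ∀ n, Measurable (x n)) :
    StronglyAdapted (pastFiltration x hx) x := fun n =>
  Measurable.stronglyMeasurable <| (measurable_pi_apply (Fin.last n)).comp
    (comap_measurable fun ω (m : Fin (n + 1)) => x m ω)

end MixedLoss

theorem proposition3 {N : ℕ}
    {K₁ K₂ : Type*} [Fintype K₁] [Fintype K₂] [Nonempty K₁] [Nonempty K₂]
    [MeasurableSpace K₁] [MeasurableSingletonClass K₁]
    [MeasurableSpace K₂] [MeasurableSingletonClass K₂]
    -- the two collections of training data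
    (u₁ : K₁ → EuclideanSpace ℝ (Fin N)) (ξ₁ : K₁ → ℝ) (hξ₁ : ∀ k, ξ₁ k = -1 ∨ ξ₁ k = 1)
    (u₂ : K₂ → EuclideanSpace ℝ (Fin N)) (ξ₂ : K₂ → ℝ) (hξ₂ : ∀ k, ξ₂ k = -1 ∨ ξ₂ k = 1)
    (α : ℝ) (hα : α ∈ Set.Ioo (0 : ℝ) 1)
    (hZ : (MixedLoss.solutionSet α u₁ ξ₁ u₂ ξ₂).Nonempty)
    -- the step sizes
    (γ : ℕ → ℝ) (hγ_pos : ∀ n, 0 < γ n)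
    (hγ_sum : Tendsto (fun n => ∑ m ∈ Finset.range n, γ m) atTop atTop)
    (hγ_sq : Summable (fun n => γ n ^ 2))
    {Ω : Type*} [MeasurableSpace Ω] (P : Measure Ω) [IsProbabilityMeasure P]
    -- the random iterates and the random index pairs
    (x : ℕ → Ω → EuclideanSpace ℝ (Fin N)) (i : ℕ → Ω → K₁) (j : ℕ → Ω → K₂)
    (hx : ∀ n, Measurable (x n)) (hx₀ : MemLp (x 0) 2 P)
    (hi : ∀ n, Measurable (i n)) (hj : ∀ n, Measurable (j n))
    (h_unif : ∀ n, P.map (fun ω => (i n ω, j n ω)) = uniformOn (Set.univ : Set (K₁ × K₂)))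
    (h_indep : ∀ n, IndepFun (fun ω => (i n ω, j n ω)) (fun ω (m : Fin (n + 1)) => x m ω) P)
    (h_iter : ∀ n, ∀ᵐ ω ∂P, x (n + 1) ω =
      MixedLoss.prox (fun z => γ n * MixedLoss.hingeLoss α (u₁ (i n ω)) (ξ₁ (i n ω)) z)
        (x n ω -
          γ n • gradient (MixedLoss.logisticLoss α (u₂ (j n ω)) (ξ₂ (j n ω))) (x n ω))) :
    ∃ y : Ω → EuclideanSpace ℝ (Fin N),
      Measurable y ∧ (∀ ω, y ω ∈ MixedLoss.solutionSet α u₁ ξ₁ u₂ ξ₂) ∧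
      (∀ᵐ ω ∂P, Tendsto (fun n => x n ω) atTop (𝓝 (y ω))) ∧
      (∀ n, MemLp (x n) 1 P) ∧ MemLp y 1 P ∧
      Tendsto (fun n => eLpNorm (x n - y) 1 P) atTop (𝓝 0) := by
  have habs₁ : ∀ k, |ξ₁ k| = 1 := fun k => by rcases hξ₁ k with h | h <;> simp [h]
  have habs₂ : ∀ k, |ξ₂ k| = 1 := fun k => by rcases hξ₂ k with h | h <;> simp [h]
  obtain ⟨U₁, hU₁⟩ := (Set.finite_range fun k => ‖u₁ k‖).bddAbove
  obtain ⟨U₂, hU₂⟩ := (Set.finite_range fun k => ‖u₂ k‖).bddAbove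
  set U := max U₁ U₂
  have hu₁ : ∀ k, ‖u₁ k‖ ≤ U := fun k => (hU₁ ⟨k, rfl⟩).trans (le_max_left _ _)
  have hu₂ : ∀ k, ‖u₂ k‖ ≤ U := fun k => (hU₂ ⟨k, rfl⟩).trans (le_max_right _ _)
  have hU : 0 ≤ U := (norm_nonneg _).trans (hu₁ (Classical.arbitrary K₁))
  obtain ⟨hα0, hα1⟩ := hα
  -- `U` bounds both the Lipschitz constants of the hinge losses and the logistic gradients, as `α`
  -- and `1 - α` are at most `1`; hence `M = (U + U)²`.
  refine MixedLoss.random_descent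
    (φ := fun (k : K₁ × K₂) x => MixedLoss.hingeLoss α (u₁ k.1) (ξ₁ k.1) x +
      MixedLoss.logisticLoss α (u₂ k.2) (ξ₂ k.2) x)
    (κ := fun n ω => (i n ω, j n ω)) (ℱ := MixedLoss.pastFiltration x hx) (M := (U + U) ^ 2)
    (fun k => (MixedLoss.continuous_hingeLoss _ _ _).add (MixedLoss.continuous_logisticLoss _ _ _))
    (fun k x => add_nonneg (MixedLoss.hingeLoss_nonneg hα0.le _ _ _)
      (MixedLoss.logisticLoss_nonneg hα1.le _ _ _))
    (fun k x => MixedLoss.hingeLoss_add_logisticLoss_le hα0.le hα1.le (habs₁ _) (habs₂ _)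
      (hu₁ _) (hu₂ _) x)
    (MixedLoss.objective_eq_sum_prod α u₁ ξ₁ u₂ ξ₂) hZ hγ_pos
    ((not_summable_iff_tendsto_nat_atTop_of_nonneg fun n => (hγ_pos n).le).2 hγ_sum) hγ_sq
    (MixedLoss.stronglyAdapted_pastFiltration x hx) hx₀ (fun n => (hi n).prodMk (hj n))
    (fun n k => ?_) h_indep (sq_nonneg _) fun z n => ?_
  · rw [← map_measureReal_apply ((hi n).prodMk (hj n)) (measurableSet_singleton k), h_unif n,
      measureReal_def, uniformOn_univ, Measure.count_singleton]
    simp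
  · filter_upwards [h_iter n] with ω hω
    refine MixedLoss.norm_proxGradient_sub_sq_le (MixedLoss.convexOn_hingeLoss hα0.le _ _)
      (hγ_pos n).le hU (fun a b => (MixedLoss.hingeLoss_sub_le hα0.le _ (habs₁ _) a b).trans ?_)
      ((MixedLoss.norm_gradient_logisticLoss_le hα1.le _ (habs₂ _) _).trans ?_)
      (MixedLoss.logisticLoss_add_inner_gradient_le hα1.le _ _ _)
      ((MixedLoss.isProxPoint_hingeLoss_iff hα0.le (hγ_pos n).le _ _ _ _).2 hω) z
    · refine mul_le_mul_of_nonneg_right ?_ (norm_nonneg _)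
      exact (mul_le_of_le_one_left (norm_nonneg _) hα1.le).trans (hu₁ _)
    · exact (mul_le_of_le_one_left (norm_nonneg _) (by linarith)).trans (hu₂ _)
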